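/- Let $K$ be a field, let $R=K[[x_1,\dots,x_n]]$ with maximal ideal $\mathfrak m$, and let $I_1,\dots,I_r$ be monomial ideals of finite colength in $R$ (that is, each $I_j$ is generated by monomials and $\dim_K R/I_j<\infty$). Let $G(I_1,\dots,I_r)$ be the group of $K$-algebra automorphisms $g$ of $R$ such that $g(I_j)=I_j$ for all $j$; it acts on the $K$-vector space $\mathfrak m/\mathfrak m^2$. Consider the decompositions $\mathfrak m/\mathfrak m^2=W_1\oplus\dots\oplus W_m$ into nonzero subspaces, each spanned by monomials (i.e. by classes of some of the variables $x_1,\dots,x_n$), such that for every $i$ and every $g\in G(I_1,\dots,I_r)$ there is an integer $k\ge 1$ with $g^k(W_1\oplus\dots\oplus W_i)=W_1\oplus\dots\oplus W_i$. Let $W_1\oplus\dots\oplus W_m$ be such a decomposition with the number $m$ of summands as large as possible. Then every $K$-algebra automorphism $g$ of $R$ that preserves degrees (it maps homogeneous elements of degree $d$ to homogeneous elements of degree $d$, for every $d$) and satisfies $g(W_i)=W_i$ for all $i$ belongs to $G(I_1,\dots,I_r)$. -/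

import Mathlib

namespace Alignment

variable (n : ℕ) (K : Type*) [Field K]

/-- The power series ring `R = K[[x_1, …, x_n]]`. -/
abbrev PS := MvPowerSeries (Fin n) K

/-- The maximal ideal of `R`. -/
noncomputable abbrev maxIdeal : Ideal (PS n K) := IsLocalRing.maximalIdeal (PS n K)

/-- The `K`-vector space `𝔪 / 𝔪 ^ 2`. -/
abbrev Cot := (maxIdeal n K).Cotangent

variable {n K}

/-- A monomial ideal: an ideal generated by a set of monomials `x ^ α`. -/
def IsMonomialIdeal (I : Ideal (PS n K)) : Prop :=
  ∃ S : Set (Fin n →₀ ℕ), I = Ideal.span ((fun α => MvPowerSeries.monomial α (1 : K)) '' S)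

/-- Finite colength: `R / I` is a finite-dimensional `K`-vector space. -/
def HasFiniteColength (I : Ideal (PS n K)) : Prop :=
  Module.Finite K (PS n K ⧸ I)

/-- The group `G(I_1, …, I_r)` of those `K`-algebra automorphisms `g` of `R` that
satisfy `g(I_j) = I_j` for all `j`. -/
def idealStabilizer {r : ℕ} (I : Fin r → Ideal (PS n K)) : Subgroup (PS n K ≃ₐ[K] PS n K) where
  carrier := {g | ∀ j, ∀ f, g f ∈ I j ↔ f ∈ I j}
  one_mem' := fun _ _ => Iff.rfl
  mul_mem' := fun {a b} ha hb j f => (ha j (b f)).trans (hb j f)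
  inv_mem' := fun {a} ha j f => by
    have h := ha j (a⁻¹ f)
    have e : a (a⁻¹ f) = f := a.apply_symm_apply f
    rw [e] at h
    exact h.symm

theorem X_mem_maxIdeal (j : Fin n) : (MvPowerSeries.X j : PS n K) ∈ maxIdeal n K := by
  rw [IsLocalRing.mem_maximalIdeal, mem_nonunits_iff, MvPowerSeries.isUnit_iff_constantCoeff]
  simp

theorem maxIdeal_le_comap (g : PS n K ≃ₐ[K] PS n K) :
    maxIdeal n K ≤ (maxIdeal n K).comap (g : PS n K →ₐ[K] PS n K) := by
  intro f hf
  rw [Ideal.mem_comap, IsLocalRing.mem_maximalIdeal, mem_nonunits_iff]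
  rw [IsLocalRing.mem_maximalIdeal, mem_nonunits_iff] at hf
  exact fun h => hf ((MulEquiv.isUnit_map g).1 h)

/-- The class of the variable `x_j` in `𝔪 / 𝔪 ^ 2`. -/
noncomputable def varClass (j : Fin n) : Cot n K :=
  (maxIdeal n K).toCotangent ⟨MvPowerSeries.X j, X_mem_maxIdeal j⟩

/-- The `K`-linear map induced on `𝔪 / 𝔪 ^ 2` by an automorphism of `R`. -/
noncomputable def cotMap (g : PS n K ≃ₐ[K] PS n K) : Cot n K →ₗ[K] Cot n K :=
  Ideal.mapCotangent (maxIdeal n K) (maxIdeal n K) (g : PS n K →ₐ[K] PS n K) (maxIdeal_le_comap g)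

/-- `g` fixes the subspace `V` of `𝔪 / 𝔪 ^ 2` (as a subspace): `g(V) = V`. -/
def Fixes (g : PS n K ≃ₐ[K] PS n K) (V : Submodule K (Cot n K)) : Prop :=
  V.map (cotMap g) = V

/-- `g` maps forms of degree `d` to forms of degree `d`, for every `d`. -/
def IsDegreePreserving (g : PS n K ≃ₐ[K] PS n K) : Prop :=
  ∀ (d : ℕ) (f : PS n K), f.IsHomogeneous d → (g f).IsHomogeneous d

/-- The decompositions `𝔪 / 𝔪 ^ 2 = W_1 ⊕ … ⊕ W_m` into nontrivial summands spanned by monomials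
(that is, by classes of variables, as monomials of higher degree vanish in `𝔪 / 𝔪 ^ 2`)
such that each partial sum `W_1 ⊕ … ⊕ W_i` is fixed by some
positive power of every element of `G(I_1, …, I_r)`. -/
structure IsAdapted {r : ℕ} (I : Fin r → Ideal (PS n K)) {m : ℕ}
    (W : Fin m → Submodule K (Cot n K)) : Prop where
  isInternal : DirectSum.IsInternal W
  ne_bot : ∀ i, W i ≠ ⊥
  spanned : ∀ i, ∃ S : Set (Fin n), W i = Submodule.span K (varClass '' S)
  partialSum_fixed : ∀ i, ∀ g ∈ idealStabilizer I, ∃ k : ℕ, 0 < k ∧ Fixes (g ^ k) (⨆ j ≤ i, W j)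

end Alignment

/-!
Every `g` in `G(I_1, …, I_r)` has a linear part, and a monomial ideal that is stable under `g` is
stable under the linear substitution by that linear part, because the terms of lowest degree of
`g(x ^ α)` again have exponents in the ideal. If `A` is the linear part of `g` and `B` that of
`g⁻¹`, then conjugating a diagonal matrix by `A` gives rank-one perturbations of the identity built
from a column of `A` and a row of `B`. Diagonal matrices stabilize every monomial ideal, and scaling
rows and columns degenerates such a perturbation to a single entry: if `A p q ≠ 0` and
`B q p' ≠ 0`, then all the transvections `x_p ↦ x_p + t x_p'` stabilize the ideal.

For fixed `a`, let `D` be the set of all `d` such that the transvections `x_a ↦ x_a + t x_d`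
stabilize `I_j`. By the above, each power of `g` maps the coordinate subspace of `D` to a coordinate
subspace; there are finitely many of these, so some positive power of `g` fixes it. Were `D` to
contain only part of the variables of some `W_i`, it could be used to refine the decomposition,
against the maximality of `m`. So `D` contains all variables in the same summand as `x_a`. An
automorphism that preserves degrees and the `W_i` is a linear substitution with block-diagonal
matrix, hence a product of diagonal matrices and transvections that stabilize every `I_j`.
-/

namespace Alignment

section LinearSubstitution

variable {σ R R' : Type*} [Fintype σ] [CommRing R] [CommRing R']

/-- The linear substitution `x_a ↦ ∑ b, A a b • x_b` in the polynomial ring. -/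
noncomputable def linSubst (A : Matrix σ σ R) : MvPolynomial σ R →ₐ[R] MvPolynomial σ R :=
  MvPolynomial.aeval fun a => ∑ b, MvPolynomial.C (A a b) * MvPolynomial.X b

theorem linSubst_X (A : Matrix σ σ R) (a : σ) :
    linSubst A (MvPolynomial.X a) = ∑ b, MvPolynomial.C (A a b) * MvPolynomial.X b :=
  MvPolynomial.aeval_X _ a

theorem linSubst_mul (A B : Matrix σ σ R) :
    linSubst (A * B) = (linSubst B).comp (linSubst A) := by
  ext1 a
  simp only [AlgHom.comp_apply, linSubst_X, map_sum, map_mul, Matrix.mul_apply,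
    MvPolynomial.algHom_C, Finset.mul_sum, Finset.sum_mul, MvPolynomial.algebraMap_eq]
  rw [Finset.sum_comm]
  exact Finset.sum_congr rfl fun b _ => Finset.sum_congr rfl fun c _ => mul_assoc _ _ _

theorem map_linSubst (φ : R →+* R') (A : Matrix σ σ R) (f : MvPolynomial σ R) :
    MvPolynomial.map φ (linSubst A f) = linSubst (A.map φ) (MvPolynomial.map φ f) := by
  induction f using MvPolynomial.induction_on with
  | C r => simp [MvPolynomial.algHom_C]
  | add p q hp hq => simp [hp, hq]
  | mul_X p a hp => simp [hp, linSubst_X]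

variable [DecidableEq σ]

theorem linSubst_diagonal_monomial (d : σ → R) (α : σ →₀ ℕ) :
    linSubst (Matrix.diagonal d) (MvPolynomial.monomial α 1) =
      (α.prod fun a k => d a ^ k) • MvPolynomial.monomial α 1 := by
  have map_X (a : σ) : linSubst (Matrix.diagonal d) (MvPolynomial.X a) =
      MvPolynomial.C (d a) * MvPolynomial.X a := by
    simp [linSubst_X, Matrix.diagonal_apply, apply_ite MvPolynomial.C]
  simp only [MvPolynomial.monomial_eq, MvPolynomial.C_1, one_mul, Finsupp.prod, map_prod, map_pow,
    map_X, mul_pow, Finset.prod_mul_distrib, MvPolynomial.smul_eq_C_mul]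

theorem linSubst_one : linSubst (1 : Matrix σ σ R) = AlgHom.id R _ := by
  ext1 a
  simp [linSubst_X, Matrix.one_apply]

variable (R) in
/-- The matrices whose linear substitution maps the span of the monomials with exponents in `S`
into itself. -/
noncomputable def expStabilizer (S : Set (σ →₀ ℕ)) : Submonoid (Matrix σ σ R) where
  carrier := {A | ∀ f ∈ MvPolynomial.restrictSupport R S,
    linSubst A f ∈ MvPolynomial.restrictSupport R S}
  one_mem' f hf := by rwa [linSubst_one]
  mul_mem' hA hB f hf := by
    rw [linSubst_mul]
    exact hB _ (hA f hf)

variable {S : Set (σ →₀ ℕ)} {A : Matrix σ σ R}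

theorem mem_expStabilizer_iff :
    A ∈ expStabilizer R S ↔ ∀ α ∈ S,
      linSubst A (MvPolynomial.monomial α 1) ∈ MvPolynomial.restrictSupport R S := by
  refine ⟨fun h α hα => h _ ((MvPolynomial.monomial_mem_restrictSupport R).2 (.inl hα)),
    fun h f hf => ?_⟩
  rw [MvPolynomial.restrictSupport_eq_span] at hf
  induction hf using Submodule.span_induction with
  | mem x hx => obtain ⟨α, hα, rfl⟩ := hx; exact h α hα
  | zero => exact (map_zero (linSubst A)).symm ▸ zero_mem _
  | add x y _ _ hx hy => exact (map_add (linSubst A) x y).symm ▸ add_mem hx hy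
  | smul c x _ hx => exact (map_smul (linSubst A) c x).symm ▸ Submodule.smul_mem _ c hx

theorem map_mem_expStabilizer (φ : R →+* R') (hA : A ∈ expStabilizer R S) :
    A.map φ ∈ expStabilizer R' S := by
  rw [mem_expStabilizer_iff] at hA ⊢
  intro α hα
  rw [← map_one φ, ← MvPolynomial.map_monomial, ← map_linSubst]
  exact (Finset.coe_subset.2 (MvPolynomial.support_map_subset φ _)).trans (hA α hα)

theorem diagonal_mem_expStabilizer (d : σ → R) : Matrix.diagonal d ∈ expStabilizer R S := by
  rw [mem_expStabilizer_iff]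
  intro α hα
  rw [linSubst_diagonal_monomial]
  exact Submodule.smul_mem _ _ ((MvPolynomial.monomial_mem_restrictSupport R).2 (.inl hα))

theorem transvection_self_mem_expStabilizer (a : σ) (c : R) :
    Matrix.transvection a a c ∈ expStabilizer R S := by
  rw [Matrix.transvection, ← Matrix.diagonal_one, ← Matrix.diagonal_single, Matrix.diagonal_add]
  exact diagonal_mem_expStabilizer _

theorem mem_expStabilizer_of_diagonal_mul [IsDomain R] {d : σ → R} (hd : ∀ a, d a ≠ 0)
    (h : Matrix.diagonal d * A ∈ expStabilizer R S) : A ∈ expStabilizer R S := by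
  rw [mem_expStabilizer_iff] at h ⊢
  intro α hα
  have hprod : (α.prod fun a k => d a ^ k) ≠ 0 :=
    Finset.prod_ne_zero_iff.2 fun a _ => pow_ne_zero _ (hd a)
  specialize h α hα
  rw [linSubst_mul, AlgHom.comp_apply, linSubst_diagonal_monomial, map_smul,
    MvPolynomial.mem_restrictSupport_iff] at h
  rwa [MvPolynomial.mem_restrictSupport_iff, ← MvPolynomial.support_smul_eq hprod]

end LinearSubstitution

section RootSubgroups

variable {σ R K : Type*} [Fintype σ] [DecidableEq σ] [CommRing R] {S : Set (σ →₀ ℕ)}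

/-- The perturbation of the identity is spread over the two sides, so that a small factor `s` can be
traded for factors `e` and `d` which are small in selected rows and columns only. -/
theorem one_add_diagonal_mul_mul_diagonal_mem [IsDomain R] {M : Matrix σ σ R} {d e : σ → R} {s : R}
    (hs : s ≠ 0) (hde : ∀ i, d i * e i = s) (hM : 1 + s • M ∈ expStabilizer R S) :
    1 + Matrix.diagonal e * M * Matrix.diagonal d ∈ expStabilizer R S := by
  have d_ne_zero (i : σ) : d i ≠ 0 := left_ne_zero_of_mul (hde i ▸ hs)
  have diagonal_mul : Matrix.diagonal d * Matrix.diagonal e = s • 1 := by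
    rw [Matrix.diagonal_mul_diagonal, funext hde, Matrix.smul_one_eq_diagonal]
  have conj : Matrix.diagonal d * (1 + Matrix.diagonal e * M * Matrix.diagonal d) =
      (1 + s • M) * Matrix.diagonal d := by
    simp only [mul_add, add_mul, ← mul_assoc, diagonal_mul, mul_one, one_mul, smul_mul_assoc]
  exact mem_expStabilizer_of_diagonal_mul d_ne_zero
    (conj ▸ mul_mem hM (diagonal_mem_expStabilizer d))

open Polynomial in
/-- Distribute `X ^ 2 = d i * e i` so that `e` survives at `X = 0` only in row `p`, and `d` only in
column `q`. -/
theorem transvection_mem_of_one_add_smul_mem [IsDomain R] {M : Matrix σ σ R} {p q : σ}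
    (hpq : p ≠ q) (hM : 1 + (X ^ 2 : R[X]) • M.map C ∈ expStabilizer R[X] S) :
    Matrix.transvection p q (M p q) ∈ expStabilizer R S := by
  let d (i : σ) : R[X] := if i = p then X ^ 2 else if i = q then 1 else X
  let e (i : σ) : R[X] := if i = p then 1 else if i = q then X ^ 2 else X
  have d_mul_e (i : σ) : d i * e i = X ^ 2 := by
    simp only [d, e]
    split_ifs <;> ring
  have eval_d : (Matrix.diagonal d).map (evalRingHom 0) = Matrix.single q q 1 := by
    rw [Matrix.diagonal_map (map_zero _), ← Matrix.diagonal_single]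
    congr 1
    ext1 i
    simp only [d, Pi.single_apply]
    split_ifs <;> simp_all
  have eval_e : (Matrix.diagonal e).map (evalRingHom 0) = Matrix.single p p 1 := by
    rw [Matrix.diagonal_map (map_zero _), ← Matrix.diagonal_single]
    congr 1
    ext1 i
    simp only [e, Pi.single_apply]
    split_ifs <;> simp
  have eval_M : (M.map C).map (evalRingHom 0) = M := by
    ext; simp
  have h := map_mem_expStabilizer (evalRingHom 0)
    (one_add_diagonal_mul_mul_diagonal_mem (pow_ne_zero 2 X_ne_zero) d_mul_e hM)
  rwa [Matrix.map_add _ (map_add _), Matrix.map_mul, Matrix.map_mul, eval_d, eval_e, eval_M,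
    Matrix.single_mul_mul_single, Matrix.map_one _ (map_zero _) (map_one _), one_mul, mul_one] at h

variable (K) in
/-- The root subgroup of the transvections `x_a ↦ x_a + t x_b` stabilizes the exponent set `S`.
The parameter `t` is an indeterminate, so that the condition is meaningful over finite `K`. -/
def HasRootSubgroup [CommRing K] (S : Set (σ →₀ ℕ)) (a b : σ) : Prop :=
  Matrix.transvection a b (Polynomial.X : Polynomial K) ∈ expStabilizer (Polynomial K) S

theorem HasRootSubgroup.refl [CommRing K] (S : Set (σ →₀ ℕ)) (a : σ) : HasRootSubgroup K S a a :=
  transvection_self_mem_expStabilizer a _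

theorem HasRootSubgroup.transvection_mem [CommRing K] [Algebra K R]
    {a b : σ} (h : HasRootSubgroup K S a b) (c : R) :
    Matrix.transvection a b c ∈ expStabilizer R S := by
  have h' := map_mem_expStabilizer (Polynomial.aeval (R := K) c).toRingHom h
  rw [Matrix.transvection, Matrix.map_add _ (map_add _), Matrix.map_single,
    Matrix.map_one _ (map_zero _) (map_one _)] at h'
  rwa [AlgHom.toRingHom_eq_coe, RingHom.coe_coe, Polynomial.aeval_X] at h'

theorem HasRootSubgroup.trans [CommRing K] {a b c : σ} (hab : HasRootSubgroup K S a b)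
    (hbc : HasRootSubgroup K S b c) : HasRootSubgroup K S a c := by
  rcases eq_or_ne a b with rfl | hne_ab
  · exact hbc
  rcases eq_or_ne b c with rfl | hne_bc
  · exact hab
  rcases eq_or_ne a c with rfl | hne_ac
  · exact .refl S a
  have commutator : Matrix.transvection a c (Polynomial.X : Polynomial K) =
      Matrix.transvection a b Polynomial.X * Matrix.transvection b c 1 *
        (Matrix.transvection a b (-Polynomial.X) * Matrix.transvection b c (-1)) := by
    simp only [Matrix.transvection, ← Matrix.single_neg, mul_add, add_mul, one_mul, mul_one,
      Matrix.single_mul_single_same, Matrix.single_mul_single_of_ne _ _ _ _ hne_ab.symm,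
      Matrix.single_mul_single_of_ne _ _ _ _ hne_bc.symm,
      Matrix.single_mul_single_of_ne _ _ _ _ hne_ac.symm, mul_neg, neg_mul]
    abel
  rw [HasRootSubgroup, commutator]
  exact mul_mem (mul_mem (hab.transvection_mem _) (hbc.transvection_mem _))
    (mul_mem (hab.transvection_mem _) (hbc.transvection_mem _))

theorem one_add_smul_vecMulVec_mem {R' : Type*} [CommRing R'] {A B : Matrix σ σ R}
    (hAB : A * B = 1) (hA : A ∈ expStabilizer R S) (hB : B ∈ expStabilizer R S) (φ : R →+* R')
    (q : σ) (c : R') :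
    1 + c • (Matrix.vecMulVec (A.col q) (B.row q)).map φ ∈ expStabilizer R' S := by
  have single_eq : Matrix.single q q c = c • Matrix.vecMulVec (Pi.single q 1) (Pi.single q 1) := by
    rw [← Matrix.single_eq_single_vecMulVec_single, Matrix.smul_single, smul_eq_mul, mul_one]
  have conj : A.map φ * Matrix.transvection q q c * B.map φ =
      1 + c • (Matrix.vecMulVec (A.col q) (B.row q)).map φ := by
    rw [Matrix.transvection, mul_add, add_mul, mul_one, ← Matrix.map_mul, hAB,
      Matrix.map_one _ (map_zero _) (map_one _), single_eq, mul_smul_comm, smul_mul_assoc,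
      Matrix.mul_vecMulVec, Matrix.vecMulVec_mul]
    congr 2
    ext i j
    simp [Matrix.vecMulVec_apply]
  exact conj ▸ mul_mem (mul_mem (map_mem_expStabilizer φ hA)
    (transvection_self_mem_expStabilizer q c)) (map_mem_expStabilizer φ hB)

open Polynomial in
theorem hasRootSubgroup_of_mul_eq_one [Field K] {A B : Matrix σ σ K} (hAB : A * B = 1)
    (hA : A ∈ expStabilizer K S) (hB : B ∈ expStabilizer K S) {p q p' : σ} (hp : A p q ≠ 0)
    (hp' : B q p' ≠ 0) : HasRootSubgroup K S p p' := by
  rcases eq_or_ne p p' with rfl | hne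
  · exact .refl S p
  let s : K[X] := C (A p q * B q p')⁻¹ * X
  let M : Matrix σ σ K[X] := s • (Matrix.vecMulVec (A.col q) (B.row q)).map C
  have hM : M p p' = X := by
    simp only [M, s, Matrix.smul_apply, Matrix.map_apply, Matrix.vecMulVec_apply, Matrix.col_apply,
      Matrix.row_apply, smul_eq_mul]
    rw [mul_right_comm, ← C_mul, inv_mul_cancel₀ (mul_ne_zero hp hp'), C_1, one_mul]
  have smul_map : (X ^ 2 * C s : K[X][X]) • (Matrix.vecMulVec (A.col q) (B.row q)).map (C.comp C) =
      (X ^ 2 : K[X][X]) • M.map C := by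
    rw [mul_smul, Matrix.map_smul' _ _ _ C.map_mul, Matrix.map_map, RingHom.coe_comp]
  have h := one_add_smul_vecMulVec_mem hAB hA hB (C.comp C) q (X ^ 2 * C s)
  rw [smul_map] at h
  rw [HasRootSubgroup, ← hM]
  exact transvection_mem_of_one_add_smul_mem hne h

end RootSubgroups

section BlockDiagonal

theorem blockDiagonal'_mulSingle_transvection {τ K : Type*} [DecidableEq τ] [CommRing K]
    {m : τ → Type*} [∀ t, DecidableEq (m t)] (t : τ) (i j : m t) (c : K) :
    Matrix.blockDiagonal' (Pi.mulSingle t (Matrix.transvection i j c)) =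
      Matrix.transvection (⟨t, i⟩ : Σ t, m t) ⟨t, j⟩ c := by
  ext ⟨k, a⟩ ⟨l, b⟩
  rw [Matrix.blockDiagonal'_apply']
  rcases eq_or_ne k l with rfl | hkl
  · rcases eq_or_ne k t with rfl | hkt
    · simp [Matrix.transvection, Matrix.one_apply, Matrix.single_apply]
    · simp [Matrix.transvection, Matrix.one_apply, hkt, hkt.symm]
  · simp only [Matrix.transvection, Matrix.add_apply, Matrix.one_apply, Matrix.single_apply,
      dif_neg hkl, Sigma.mk.injEq]
    grind

theorem blockDiagonal'_mem_of_diagonal_mem_of_transvection_mem {τ K : Type*} [Fintype τ]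
    [DecidableEq τ] [Field K] {m : τ → Type*} [∀ t, Fintype (m t)] [∀ t, DecidableEq (m t)]
    {T : Submonoid (Matrix (Σ t, m t) (Σ t, m t) K)}
    (hdiag : ∀ d, Matrix.diagonal d ∈ T)
    (htrans : ∀ t (i j : m t) c, i ≠ j → Matrix.transvection ⟨t, i⟩ ⟨t, j⟩ c ∈ T)
    (M : ∀ t, Matrix (m t) (m t) K) : Matrix.blockDiagonal' M ∈ T := by
  suffices ∀ t (B : Matrix (m t) (m t) K), Matrix.blockDiagonal' (Pi.mulSingle t B) ∈ T from
    Submonoid.pi_mem_of_mulSingle_mem (H := T.comap (Matrix.blockDiagonal'RingHom m K)) M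
      fun t => this t (M t)
  intro t B
  induction B using Matrix.diagonal_transvection_induction with
  | hdiag D _ =>
    have : (Pi.mulSingle t (Matrix.diagonal D) : ∀ k, Matrix (m k) (m k) K) =
        fun k => Matrix.diagonal ((Pi.mulSingle t D : ∀ k, m k → K) k) :=
      funext fun k => (Pi.apply_mulSingle (fun _ => Matrix.diagonal) (fun _ => Matrix.diagonal_one)
        t D k).symm
    rw [this]
    exact Set.mem_of_eq_of_mem (Matrix.blockDiagonal'_diagonal _) (hdiag _)
  | htransvec s =>
    obtain ⟨i, j, hij, c⟩ := s
    exact Set.mem_of_eq_of_mem (blockDiagonal'_mulSingle_transvection t i j c) (htrans t i j c hij)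
  | hmul B C hB hC =>
    rw [Pi.mulSingle_mul]
    exact Set.mem_of_eq_of_mem (Matrix.blockDiagonal'_mul _ _) (mul_mem hB hC)

theorem mem_of_diagonal_mem_of_transvection_mem {σ τ K : Type*} [Fintype σ] [DecidableEq σ]
    [Field K] {T : Submonoid (Matrix σ σ K)} {ℓ : σ → τ} (hdiag : ∀ d, Matrix.diagonal d ∈ T)
    (htrans : ∀ i j c, i ≠ j → ℓ i = ℓ j → Matrix.transvection i j c ∈ T) {A : Matrix σ σ K}
    (hA : ∀ i j, A i j ≠ 0 → ℓ i = ℓ j) : A ∈ T := by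
  classical
  let ℓ' := Set.rangeFactorization ℓ
  let e := Equiv.sigmaFiberEquiv ℓ'
  have diagonal_mem (d) : Matrix.diagonal d ∈ T.comap (Matrix.reindexAlgEquiv K K e) := by
    rw [Submonoid.mem_comap, Matrix.coe_reindexAlgEquiv, Matrix.reindex_apply,
      Matrix.submatrix_diagonal_equiv]
    exact hdiag _
  have transvection_mem (t) (i j : {x // ℓ' x = t}) (c : K) (hij : i ≠ j) :
      Matrix.transvection ⟨t, i⟩ ⟨t, j⟩ c ∈ T.comap (Matrix.reindexAlgEquiv K K e) := by
    rw [Submonoid.mem_comap, Matrix.transvection, map_add, map_one, Matrix.coe_reindexAlgEquiv,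
      Matrix.reindex_apply, Matrix.submatrix_single_equiv]
    exact htrans i j c (Subtype.coe_ne_coe.2 hij) (congrArg Subtype.val (i.2.trans j.2.symm))
  have eq_reindex : A = Matrix.reindexAlgEquiv K K e
      (Matrix.blockDiagonal' fun t => A.submatrix Subtype.val Subtype.val) := by
    ext i j
    rw [Matrix.coe_reindexAlgEquiv, Matrix.reindex_apply, Matrix.submatrix_apply,
      Matrix.blockDiagonal'_apply]
    have hsymm (a) : e.symm a = ⟨ℓ' a, a, rfl⟩ := rfl
    simp only [hsymm]
    split_ifs with h
    · rw [Matrix.submatrix_apply]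
      congr 1
      grind
    · exact not_not.1 (mt (hA i j) fun hij => h (Subtype.ext hij))
  rw [eq_reindex]
  exact blockDiagonal'_mem_of_diagonal_mem_of_transvection_mem diagonal_mem transvection_mem _

end BlockDiagonal

section MonomialIdeals

variable {σ R : Type*} [CommRing R]

theorem mem_span_monomial_of_finset (Γ : Finset (σ →₀ ℕ)) (f : MvPowerSeries σ R)
    (hf : ∀ β, f.coeff β ≠ 0 → ∃ γ ∈ Γ, γ ≤ β) :
    f ∈ Ideal.span ((fun α => MvPowerSeries.monomial α (1 : R)) '' Γ) := by
  classical
  induction Γ using Finset.induction_on generalizing f with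
  | empty =>
    have : f = 0 := MvPowerSeries.ext fun β => by
      by_contra h
      obtain ⟨γ, hγ, _⟩ := hf β h
      exact Finset.notMem_empty γ hγ
    exact this ▸ zero_mem _
  | insert γ Γ _ ih =>
    let q : MvPowerSeries σ R := fun β => f.coeff (γ + β)
    have coeff_sub (β) : (f - MvPowerSeries.monomial γ 1 * q).coeff β =
        if γ ≤ β then 0 else f.coeff β := by
      rw [map_sub, MvPowerSeries.coeff_monomial_mul, one_mul]
      split_ifs with h
      · exact sub_eq_zero.2 (congrArg (f.coeff ·) (add_tsub_cancel_of_le h).symm)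
      · exact sub_zero _
    have sub_mem := ih (f - MvPowerSeries.monomial γ 1 * q) fun β hβ => by
      rw [coeff_sub, ite_ne_left_iff] at hβ
      obtain ⟨γ', hγ', hle⟩ := hf β hβ.2.symm
      exact ⟨γ', Finset.mem_of_mem_insert_of_ne hγ' fun h => hβ.1 (h ▸ hle), hle⟩
    rw [← sub_add_cancel f (MvPowerSeries.monomial γ 1 * q)]
    refine add_mem (Ideal.span_mono (Set.image_mono ?_) sub_mem)
      (Ideal.mul_mem_right _ _ (Ideal.subset_span ⟨γ, Finset.mem_insert_self γ Γ, rfl⟩))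
    exact Finset.coe_subset.2 (Finset.subset_insert γ Γ)

theorem exists_le_of_mem_span_monomial {S : Set (σ →₀ ℕ)} {f : MvPowerSeries σ R}
    (hf : f ∈ Ideal.span ((fun α => MvPowerSeries.monomial α (1 : R)) '' S)) {β : σ →₀ ℕ}
    (hβ : f.coeff β ≠ 0) : ∃ γ ∈ S, γ ≤ β := by
  classical
  induction hf using Submodule.span_induction generalizing β with
  | mem x hx =>
    obtain ⟨α, hα, rfl⟩ := hx
    exact ⟨α, hα, (MvPowerSeries.eq_of_coeff_monomial_ne_zero hβ).ge⟩
  | zero => exact absurd (map_zero _) hβ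
  | add x y _ _ hx hy =>
    by_cases h : x.coeff β = 0
    · exact hy fun h' => hβ (by rw [map_add, h, h', add_zero])
    · exact hx h
  | smul c x _ hx =>
    rw [smul_eq_mul, MvPowerSeries.coeff_mul] at hβ
    obtain ⟨p, hp, hne⟩ := Finset.exists_ne_zero_of_sum_ne_zero hβ
    obtain ⟨γ, hγ, hle⟩ := hx (right_ne_zero_of_mul hne)
    exact ⟨γ, hγ, hle.trans (Finset.HasAntidiagonal.mem_antidiagonal.1 hp ▸ le_add_self)⟩

/-- Dickson's lemma reduces to finitely many generators, which is essential: a power series may have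
infinitely many terms. -/
theorem mem_span_monomial_iff [Finite σ] {S : Set (σ →₀ ℕ)} {f : MvPowerSeries σ R} :
    f ∈ Ideal.span ((fun α => MvPowerSeries.monomial α (1 : R)) '' S) ↔
      ∀ β, f.coeff β ≠ 0 → ∃ γ ∈ S, γ ≤ β := by
  refine ⟨fun hf β => exists_le_of_mem_span_monomial hf, fun hf => ?_⟩
  have hpwo : S.IsPWO := Set.isPWO_of_wellQuasiOrderedLE S
  have minimal_finite : {γ | Minimal (· ∈ S) γ}.Finite :=
    (setOfPred_minimal_antichain (· ∈ S)).finite_of_partiallyWellOrderedOn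
      (hpwo.mono fun γ hγ => hγ.1)
  have h := mem_span_monomial_of_finset minimal_finite.toFinset f fun β hβ => by
    obtain ⟨γ, hγ, hle⟩ := hf β hβ
    obtain ⟨δ, hδ, hmin⟩ := hpwo.exists_le_minimal hγ
    exact ⟨δ, minimal_finite.mem_toFinset.2 hmin, hδ.trans hle⟩
  rw [minimal_finite.coe_toFinset] at h
  exact Ideal.span_mono (Set.image_mono fun γ hγ => hγ.1) h

/-- The exponents of the monomials contained in an ideal. -/
def exponents (I : Ideal (MvPowerSeries σ R)) : Set (σ →₀ ℕ) :=
  {α | MvPowerSeries.monomial α (1 : R) ∈ I}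

theorem IsMonomialIdeal.mem_iff {n : ℕ} {K : Type*} [Field K] {I : Ideal (PS n K)}
    (hI : IsMonomialIdeal I) {f : PS n K} :
    f ∈ I ↔ ∀ β, f.coeff β ≠ 0 → β ∈ exponents I := by
  classical
  obtain ⟨S, rfl⟩ := hI
  rw [mem_span_monomial_iff]
  refine forall_congr' fun β => imp_congr_right fun _ => ?_
  rw [exponents, Set.mem_ofPred_eq, mem_span_monomial_iff]
  refine ⟨fun h β' hβ' => ?_, fun h => h β ?_⟩
  · rwa [MvPowerSeries.eq_of_coeff_monomial_ne_zero hβ']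
  · rw [MvPowerSeries.coeff_monomial_same]
    exact one_ne_zero

end MonomialIdeals

theorem map_mem_iff_of_forall_map_mem {R : Type*} [CommRing R] [IsNoetherianRing R] {e : R ≃+* R}
    {I : Ideal R} (h : ∀ f ∈ I, e f ∈ I) (f : R) : e f ∈ I ↔ f ∈ I := by
  have comap_strictMono : StrictMono (Ideal.comap (e : R →+* R)) :=
    Monotone.strictMono_of_injective (fun _ _ => Ideal.comap_mono)
      (Ideal.comap_injective_of_surjective (e : R →+* R) e.surjective)
  have eq_comap : I = I.comap (e : R →+* R) := eq_of_le_of_not_lt h fun hlt =>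
    not_strictMono_of_wellFoundedGT _ (comap_strictMono.strictMono_iterate_of_lt_map hlt)
  exact (SetLike.ext_iff.1 eq_comap f).symm

section Cotangent

variable {n : ℕ} {K : Type*} [Field K]

theorem mem_maxIdeal_iff_one_le_order {f : PS n K} : f ∈ maxIdeal n K ↔ 1 ≤ f.order := by
  rw [MvPowerSeries.one_le_order_iff_constCoeff_eq_zero, IsLocalRing.mem_maximalIdeal,
    mem_nonunits_iff, MvPowerSeries.isUnit_iff_constantCoeff, isUnit_iff_ne_zero, not_not]

theorem monomial_mem_maxIdeal_pow (α : Fin n →₀ ℕ) :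
    MvPowerSeries.monomial α (1 : K) ∈ maxIdeal n K ^ α.degree := by
  rw [MvPowerSeries.monomial_one_eq, Finsupp.degree_apply, ← Finset.prod_pow_eq_pow_sum]
  exact Ideal.prod_mem_prod fun a _ => Ideal.pow_mem_pow (X_mem_maxIdeal a) (α a)

theorem mem_maxIdeal_pow_of_le_order {d : ℕ} {f : PS n K} (h : d ≤ f.order) :
    f ∈ maxIdeal n K ^ d := by
  have mem_span : f ∈ Ideal.span
      ((fun α => MvPowerSeries.monomial α (1 : K)) '' {α | α.degree = d}) :=
    mem_span_monomial_iff.2 fun β hβ =>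
      have d_le_degree : d ≤ β.degree :=
        ENat.natCast_le_natCast.1 (h.trans (MvPowerSeries.order_le hβ))
      (β.exists_le_degree_eq d d_le_degree).imp fun _ => And.symm
  refine Ideal.span_le.2 ?_ mem_span
  rintro _ ⟨α, rfl, rfl⟩
  exact monomial_mem_maxIdeal_pow α

/-- The coefficients of the linear terms, as a linear map on `𝔪 / 𝔪 ^ 2`. -/
noncomputable def linCoeff : Cot n K →ₗ[K] (Fin n → K) :=
  Ideal.Cotangent.lift
    (LinearMap.pi (fun b => MvPowerSeries.coeff (R := K) (Finsupp.single b 1)) ∘ₗ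
      ((maxIdeal n K).restrictScalars K).subtype) fun x y => by
    have two_le_order : 2 ≤ (x * y : PS n K).order :=
      (add_le_add (mem_maxIdeal_iff_one_le_order.1 x.2)
        (mem_maxIdeal_iff_one_le_order.1 y.2)).trans MvPowerSeries.le_order_mul
    ext b
    refine MvPowerSeries.coeff_of_lt_order (lt_of_lt_of_le ?_ two_le_order)
    rw [Finsupp.degree_single]
    exact ENat.natCast_lt_natCast.2 one_lt_two

theorem linCoeff_toCotangent (x : maxIdeal n K) (b : Fin n) :
    linCoeff ((maxIdeal n K).toCotangent x) b = (x : PS n K).coeff (Finsupp.single b 1) := rfl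

theorem linCoeff_varClass (a : Fin n) : linCoeff (varClass a : Cot n K) = Pi.single a 1 := by
  ext b
  rw [varClass, linCoeff_toCotangent, MvPowerSeries.coeff_index_single_X, Pi.single_apply]

theorem linCoeff_injective : Function.Injective (linCoeff (n := n) (K := K)) := by
  rw [injective_iff_map_eq_zero]
  intro x hx
  obtain ⟨⟨f, hf⟩, rfl⟩ := (maxIdeal n K).toCotangent_surjective x
  rw [Ideal.toCotangent_eq_zero]
  refine mem_maxIdeal_pow_of_le_order (MvPowerSeries.nat_le_order fun β hβ => ?_)
  obtain h | h : β.degree < 1 ∨ β.degree = 1 := by lia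
  · exact MvPowerSeries.coeff_of_lt_order (lt_of_lt_of_le (ENat.natCast_lt_natCast.2 h)
      (mem_maxIdeal_iff_one_le_order.1 hf))
  · obtain ⟨b, rfl⟩ := (Finsupp.sum_eq_one_iff β).1 h
    exact congrFun hx b

theorem linCoeff_surjective : Function.Surjective (linCoeff (n := n) (K := K)) := by
  refine fun c => ⟨∑ a, c a • varClass a, ?_⟩
  simp only [map_sum, map_smul, linCoeff_varClass]
  exact (pi_eq_sum_univ' c).symm

/-- The basis of `𝔪 / 𝔪 ^ 2` that consists of the classes of the variables. -/
noncomputable def varBasis : Module.Basis (Fin n) K (Cot n K) :=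
  .ofEquivFun (.ofBijective linCoeff ⟨linCoeff_injective, linCoeff_surjective⟩)

theorem coe_varBasis : ⇑(varBasis : Module.Basis (Fin n) K (Cot n K)) = varClass := by
  ext1 a
  rw [varBasis, Module.Basis.coe_ofEquivFun, LinearEquiv.symm_apply_eq]
  exact (linCoeff_varClass a).symm

theorem varBasis_repr (x : Cot n K) (b : Fin n) : varBasis.repr x b = linCoeff x b := by
  rw [varBasis, Module.Basis.ofEquivFun_repr_apply]
  rfl

end Cotangent

section LinearPart

variable {n : ℕ} {K : Type*} [Field K]

theorem cotMap_mul (g h : PS n K ≃ₐ[K] PS n K) : cotMap (g * h) = cotMap g ∘ₗ cotMap h := by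
  ext x
  obtain ⟨x, rfl⟩ := (maxIdeal n K).toCotangent_surjective x
  rfl

theorem cotMap_one : cotMap (1 : PS n K ≃ₐ[K] PS n K) = LinearMap.id := by
  ext x
  obtain ⟨x, rfl⟩ := (maxIdeal n K).toCotangent_surjective x
  rfl

theorem cotMap_injective (g : PS n K ≃ₐ[K] PS n K) : Function.Injective (cotMap g) :=
  Function.LeftInverse.injective (g := cotMap g⁻¹) fun x => by
    rw [← LinearMap.comp_apply, ← cotMap_mul, inv_mul_cancel, cotMap_one, LinearMap.id_apply]

/-- The matrix of the linear part of an automorphism: row `a` holds the coefficients of the linear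
terms of `g x_a`. -/
noncomputable def linMatrix (g : PS n K ≃ₐ[K] PS n K) : Matrix (Fin n) (Fin n) K :=
  Matrix.of fun a b => (g (MvPowerSeries.X a)).coeff (Finsupp.single b 1)

theorem linCoeff_cotMap_varClass (g : PS n K ≃ₐ[K] PS n K) (a b : Fin n) :
    linCoeff (cotMap g (varClass a)) b = linMatrix g a b := rfl

theorem linCoeff_cotMap (g : PS n K ≃ₐ[K] PS n K) (x : Cot n K) :
    linCoeff (cotMap g x) = Matrix.vecMul (linCoeff x) (linMatrix g) := by
  ext b
  conv_lhs => rw [← varBasis.sum_repr x]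
  simp only [coe_varBasis, varBasis_repr, map_sum, map_smul, Finset.sum_apply, Pi.smul_apply,
    linCoeff_cotMap_varClass, smul_eq_mul, Matrix.vecMul, dotProduct]

theorem linMatrix_mul (g h : PS n K ≃ₐ[K] PS n K) :
    linMatrix (g * h) = linMatrix h * linMatrix g := by
  ext a b
  rw [← linCoeff_cotMap_varClass, cotMap_mul, LinearMap.comp_apply, linCoeff_cotMap]
  rfl

theorem linMatrix_one : linMatrix (1 : PS n K ≃ₐ[K] PS n K) = 1 := by
  ext a b
  rw [← linCoeff_cotMap_varClass, cotMap_one, LinearMap.id_apply, linCoeff_varClass,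
    Matrix.one_eq_pi_single]

theorem linMatrix_mul_linMatrix_inv (g : PS n K ≃ₐ[K] PS n K) :
    linMatrix g * linMatrix g⁻¹ = 1 := by
  rw [← linMatrix_mul, inv_mul_cancel, linMatrix_one]

end LinearPart

section InitialForm

open MvPowerSeries (homogeneousComponent)

variable {σ R : Type*} [CommRing R] {d e : ℕ} {f f' p p' : MvPowerSeries σ R}

/-- The power series `f` has no terms of degree less than `d`, and `p` is its part of degree `d`. -/
def IsInitialForm (d : ℕ) (f p : MvPowerSeries σ R) : Prop :=
  d ≤ f.order ∧ homogeneousComponent d f = p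

theorem IsInitialForm.one : IsInitialForm 0 (1 : MvPowerSeries σ R) 1 := by
  classical
  refine ⟨zero_le, (MvPowerSeries.isHomogeneous_iff_eq_homogeneousComponent.1 ?_).symm⟩
  intro β hβ
  rw [MvPowerSeries.coeff_one, ite_ne_right_iff] at hβ
  rw [hβ.1, map_zero]

theorem IsInitialForm.mul (h : IsInitialForm d f p) (h' : IsInitialForm e f' p') :
    IsInitialForm (d + e) (f * f') (p * p') := by
  refine ⟨?_, ?_⟩
  · rw [Nat.cast_add]
    exact (add_le_add h.1 h'.1).trans MvPowerSeries.le_order_mul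
  · rw [MvPowerSeries.homogeneousComponent_mul_of_le_order h.1 h'.1, h.2, h'.2]

theorem IsInitialForm.pow (h : IsInitialForm d f p) (k : ℕ) :
    IsInitialForm (k * d) (f ^ k) (p ^ k) := by
  induction k with
  | zero => simpa only [zero_mul, pow_zero] using IsInitialForm.one
  | succ k ih => simpa only [Nat.succ_mul, pow_succ] using ih.mul h

theorem IsInitialForm.prod {ι : Type*} (s : Finset ι) {d : ι → ℕ}
    {f p : ι → MvPowerSeries σ R} (h : ∀ i ∈ s, IsInitialForm (d i) (f i) (p i)) :
    IsInitialForm (∑ i ∈ s, d i) (∏ i ∈ s, f i) (∏ i ∈ s, p i) := by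
  induction s using Finset.cons_induction with
  | empty => exact IsInitialForm.one
  | cons i s hi ih =>
    simp only [Finset.sum_cons, Finset.prod_cons]
    exact (h i (Finset.mem_cons_self i s)).mul (ih fun j hj => h j (Finset.mem_cons_of_mem hj))

theorem IsInitialForm.eq_of_isHomogeneous (h : IsInitialForm d f p) (hf : f.IsHomogeneous d) :
    f = p :=
  (MvPowerSeries.isHomogeneous_iff_eq_homogeneousComponent.1 hf).trans h.2

end InitialForm

section LinearPartOnMonomials

variable {n : ℕ} {K : Type*} [Field K] {g : PS n K ≃ₐ[K] PS n K} {I : Ideal (PS n K)}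

theorem isInitialForm_map_X (g : PS n K ≃ₐ[K] PS n K) (a : Fin n) :
    IsInitialForm 1 (g (MvPowerSeries.X a)) (linSubst (linMatrix g) (MvPolynomial.X a)) := by
  classical
  refine ⟨mem_maxIdeal_iff_one_le_order.1 (maxIdeal_le_comap g (X_mem_maxIdeal a)), ?_⟩
  ext β
  simp only [MvPowerSeries.coeff_homogeneousComponent, linSubst_X, MvPolynomial.coeff_coe,
    MvPolynomial.coeff_sum, MvPolynomial.coeff_C_mul, MvPolynomial.coeff_X]
  split_ifs with hβ
  · obtain ⟨b, rfl⟩ := (Finsupp.sum_eq_one_iff β).1 hβ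
    simp [linMatrix, Finsupp.single_left_inj]
  · refine (Finset.sum_eq_zero fun b _ => ?_).symm
    rw [if_neg, mul_zero]
    rintro rfl
    exact hβ (Finsupp.degree_single b 1)

theorem isInitialForm_map_monomial (g : PS n K ≃ₐ[K] PS n K) (α : Fin n →₀ ℕ) :
    IsInitialForm α.degree (g (MvPowerSeries.monomial α 1))
      (linSubst (linMatrix g) (MvPolynomial.monomial α 1)) := by
  rw [MvPowerSeries.monomial_one_eq, MvPolynomial.monomial_eq, MvPolynomial.C_1, one_mul,
    Finsupp.degree_apply, Finsupp.prod, ← MvPolynomial.coeToMvPowerSeries.ringHom_apply]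
  simp only [Finsupp.prod, map_prod, map_pow]
  refine IsInitialForm.prod _ fun a _ => ?_
  simpa only [mul_one, MvPolynomial.coeToMvPowerSeries.ringHom_apply] using
    (isInitialForm_map_X g a).pow (α a)

theorem linMatrix_mem_expStabilizer (hI : IsMonomialIdeal I) (hg : ∀ f ∈ I, g f ∈ I) :
    linMatrix g ∈ expStabilizer K (exponents I) := by
  rw [mem_expStabilizer_iff]
  intro α hα
  rw [MvPolynomial.mem_restrictSupport_iff]
  intro β hβ
  rw [SetLike.mem_coe, MvPolynomial.mem_support_iff, ← MvPolynomial.coeff_coe,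
    ← (isInitialForm_map_monomial g α).2, MvPowerSeries.coeff_homogeneousComponent,
    ite_ne_right_iff] at hβ
  exact hI.mem_iff.1 (hg _ hα) β hβ.2

theorem IsDegreePreserving.map_monomial (hg : IsDegreePreserving g) (α : Fin n →₀ ℕ) :
    g (MvPowerSeries.monomial α 1) =
      linSubst (linMatrix g) (MvPolynomial.monomial α 1) := by
  classical
  refine (isInitialForm_map_monomial g α).eq_of_isHomogeneous (hg _ _ fun {β} hβ => ?_)
  rw [MvPowerSeries.eq_of_coeff_monomial_ne_zero hβ, Finsupp.degree_eq_weight_one]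
  rfl

theorem IsDegreePreserving.map_mem (hg : IsDegreePreserving g) (hI : IsMonomialIdeal I)
    (h : linMatrix g ∈ expStabilizer K (exponents I)) {f : PS n K} (hf : f ∈ I) : g f ∈ I := by
  obtain ⟨S, hS⟩ := id hI
  suffices I ≤ I.comap g from this hf
  conv_lhs => rw [hS]
  rw [Ideal.span_le]
  rintro _ ⟨α, hα, rfl⟩
  have mem_exponents : α ∈ exponents I := by
    rw [exponents, Set.mem_ofPred_eq, hS]
    exact Ideal.subset_span ⟨α, hα, rfl⟩
  rw [SetLike.mem_coe, Ideal.mem_comap, hg.map_monomial, hI.mem_iff]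
  intro β hβ
  rw [MvPolynomial.coeff_coe, ← MvPolynomial.mem_support_iff] at hβ
  exact mem_expStabilizer_iff.1 h α mem_exponents hβ

end LinearPartOnMonomials

section CoordinateSubspaces

variable {n : ℕ} {K : Type*} [Field K] {g : PS n K ≃ₐ[K] PS n K} {D E : Set (Fin n)}

variable (K) in
/-- The subspace of `𝔪 / 𝔪 ^ 2` spanned by the classes of the variables with index in `D`. -/
noncomputable def coordSpan (D : Set (Fin n)) : Submodule K (Cot n K) :=
  Submodule.span K (varClass '' D)

theorem mem_coordSpan {x : Cot n K} : x ∈ coordSpan K D ↔ ∀ b ∉ D, linCoeff x b = 0 := by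
  rw [coordSpan, ← coe_varBasis, Module.Basis.mem_span_image, Set.subset_def]
  simp only [SetLike.mem_coe, Finsupp.mem_support_iff, varBasis_repr, not_imp_comm]

theorem varClass_mem_coordSpan {a : Fin n} : (varClass a : Cot n K) ∈ coordSpan K D ↔ a ∈ D := by
  rw [coordSpan, ← coe_varBasis]
  exact ⟨not_imp_not.1 (varBasis.linearIndependent.notMem_span_image (s := D)),
    fun ha => Submodule.subset_span (Set.mem_image_of_mem _ ha)⟩

theorem coordSpan_eq_bot_iff : coordSpan K D = ⊥ ↔ D = ∅ := by
  refine ⟨fun h => Set.eq_empty_of_forall_notMem fun a ha => varBasis.ne_zero (R := K) a ?_, ?_⟩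
  · rw [coe_varBasis, ← Submodule.mem_bot K, ← h]
    exact varClass_mem_coordSpan.2 ha
  · rintro rfl
    rw [coordSpan, Set.image_empty, Submodule.span_empty]

theorem coordSpan_univ : coordSpan K (Set.univ : Set (Fin n)) = ⊤ := by
  rw [coordSpan, Set.image_univ, ← coe_varBasis, varBasis.span_eq]

theorem iSup_coordSpan {ι : Sort*} (D : ι → Set (Fin n)) :
    ⨆ i, coordSpan K (D i) = coordSpan K (⋃ i, D i) := by
  simp only [coordSpan, Set.image_iUnion, Submodule.span_iUnion]

theorem disjoint_coordSpan (h : Disjoint D E) : Disjoint (coordSpan K D) (coordSpan K E) := by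
  rw [coordSpan, coordSpan, ← coe_varBasis]
  exact varBasis.linearIndependent.disjoint_span_image h

theorem map_cotMap_coordSpan_le_iff :
    (coordSpan K D).map (cotMap g) ≤ coordSpan K E ↔ ∀ a ∈ D, ∀ b ∉ E, linMatrix g a b = 0 := by
  rw [coordSpan, Submodule.map_span_le, Set.forall_mem_image]
  exact forall₂_congr fun _ _ => mem_coordSpan

theorem fixes_coordSpan_iff :
    Fixes g (coordSpan K D) ↔ ∀ a ∈ D, ∀ b ∉ D, linMatrix g a b = 0 := by
  have : Module.Finite K (Cot n K) := .of_basis varBasis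
  rw [← map_cotMap_coordSpan_le_iff]
  exact ⟨Eq.le, fun h => Submodule.eq_of_le_of_finrank_eq h
    (Submodule.equivMapOfInjective _ (cotMap_injective g) _).finrank_eq.symm⟩

theorem map_cotMap_coordSpan_eq
    (hD : ∀ p ∈ D, ∀ q, linMatrix g p q ≠ 0 → ∀ p', linMatrix g⁻¹ q p' ≠ 0 → p' ∈ D) :
    (coordSpan K D).map (cotMap g) = coordSpan K {q | ∃ p ∈ D, linMatrix g p q ≠ 0} := by
  refine le_antisymm (map_cotMap_coordSpan_le_iff.2 fun p hp q hq => ?_) ?_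
  · by_contra h
    exact hq ⟨p, hp, h⟩
  · rw [coordSpan, Submodule.span_le]
    rintro _ ⟨q, ⟨p, hp, hpq⟩, rfl⟩
    refine ⟨cotMap g⁻¹ (varClass q), mem_coordSpan.2 fun p' hp' => ?_, ?_⟩
    · exact not_not.1 (mt (hD p hp q hpq p') hp')
    · rw [← LinearMap.comp_apply, ← cotMap_mul, mul_inv_cancel, cotMap_one, LinearMap.id_apply]

theorem exists_pow_fixes_coordSpan
    (h : ∀ k : ℕ, ∃ E, (coordSpan K D).map (cotMap (g ^ k)) = coordSpan K E) :
    ∃ k : ℕ, 0 < k ∧ Fixes (g ^ k) (coordSpan K D) := by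
  choose E hE using h
  obtain ⟨k, l, hkl, heq⟩ : ∃ k l, k < l ∧ E k = E l :=
    Set.finite_univ.exists_lt_map_eq_of_forall_mem fun k => Set.mem_univ (E k)
  refine ⟨l - k, Nat.sub_pos_of_lt hkl,
    Submodule.map_injective_of_injective (cotMap_injective (g ^ k)) ?_⟩
  rw [← Submodule.map_comp, ← cotMap_mul, ← pow_add, Nat.add_sub_cancel' hkl.le, hE, hE, heq]

end CoordinateSubspaces

section PowFixed

variable {n : ℕ} {K : Type*} [Field K] {G : Subgroup (PS n K ≃ₐ[K] PS n K)} {D E : Set (Fin n)}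

theorem Fixes.pow {g : PS n K ≃ₐ[K] PS n K} {V : Submodule K (Cot n K)} (h : Fixes g V) (k : ℕ) :
    Fixes (g ^ k) V := by
  induction k with
  | zero => rw [pow_zero, Fixes, cotMap_one, Submodule.map_id]
  | succ k ih => rw [pow_succ, Fixes, cotMap_mul, Submodule.map_comp, h, ih]

/-- Every element of `G` has a positive power that fixes the coordinate subspace of `D`: the
condition on the partial sums in `IsAdapted`. -/
def IsPowFixed (G : Subgroup (PS n K ≃ₐ[K] PS n K)) (D : Set (Fin n)) : Prop :=
  ∀ g ∈ G, ∃ k : ℕ, 0 < k ∧ Fixes (g ^ k) (coordSpan K D)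

theorem IsPowFixed.empty (G : Subgroup (PS n K ≃ₐ[K] PS n K)) : IsPowFixed G ∅ := fun _ _ =>
  ⟨1, one_pos, fixes_coordSpan_iff.2 fun _ ha => absurd ha (Set.notMem_empty _)⟩

theorem IsPowFixed.univ (G : Subgroup (PS n K ≃ₐ[K] PS n K)) : IsPowFixed G Set.univ := fun _ _ =>
  ⟨1, one_pos, fixes_coordSpan_iff.2 fun _ _ b hb => absurd (Set.mem_univ b) hb⟩

theorem IsPowFixed.exists_common (hD : IsPowFixed G D) (hE : IsPowFixed G E) :
    ∀ g ∈ G, ∃ k : ℕ, 0 < k ∧ Fixes (g ^ k) (coordSpan K D) ∧ Fixes (g ^ k) (coordSpan K E) := by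
  intro g hg
  obtain ⟨k, hk, hDk⟩ := hD g hg
  obtain ⟨l, hl, hEl⟩ := hE g hg
  exact ⟨k * l, Nat.mul_pos hk hl, pow_mul g k l ▸ hDk.pow l, pow_mul' g k l ▸ hEl.pow k⟩

theorem IsPowFixed.inter (hD : IsPowFixed G D) (hE : IsPowFixed G E) : IsPowFixed G (D ∩ E) := by
  intro g hg
  obtain ⟨k, hk, hDk, hEk⟩ := hD.exists_common hE g hg
  rw [fixes_coordSpan_iff] at hDk hEk
  refine ⟨k, hk, fixes_coordSpan_iff.2 fun a ha b hb => ?_⟩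
  by_cases hbD : b ∈ D
  · exact hEk a ha.2 b fun hbE => hb ⟨hbD, hbE⟩
  · exact hDk a ha.1 b hbD

theorem IsPowFixed.union (hD : IsPowFixed G D) (hE : IsPowFixed G E) : IsPowFixed G (D ∪ E) := by
  intro g hg
  obtain ⟨k, hk, hDk, hEk⟩ := hD.exists_common hE g hg
  refine ⟨k, hk, ?_⟩
  rw [fixes_coordSpan_iff] at hDk hEk ⊢
  rintro a (ha | ha) b hb
  · exact hDk a ha b fun hbD => hb (.inl hbD)
  · exact hEk a ha b fun hbE => hb (.inr hbE)

theorem isPowFixed_setOf_hasRootSubgroup {r : ℕ} {I : Fin r → Ideal (PS n K)} {j : Fin r}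
    (hmon : IsMonomialIdeal (I j)) (a : Fin n) :
    IsPowFixed (idealStabilizer I) {d | HasRootSubgroup K (exponents (I j)) a d} := by
  refine fun g hg => exists_pow_fixes_coordSpan fun k => ⟨_, map_cotMap_coordSpan_eq ?_⟩
  have linMatrix_mem (h) (hh : h ∈ idealStabilizer I) :
      linMatrix h ∈ expStabilizer K (exponents (I j)) :=
    linMatrix_mem_expStabilizer hmon fun f hf => (hh j f).2 hf
  intro p hp q hq p' hp'
  exact hp.trans (hasRootSubgroup_of_mul_eq_one (linMatrix_mul_linMatrix_inv (g ^ k))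
    (linMatrix_mem _ (pow_mem hg k)) (linMatrix_mem _ (inv_mem (pow_mem hg k))) hq hp')

end PowFixed

section Levels

variable {n r m : ℕ} {K : Type*} [Field K] {I : Fin r → Ideal (PS n K)}
  {W : Fin m → Submodule K (Cot n K)} {ℓ : Fin n → Fin m}

theorem IsAdapted.exists_level (hW : IsAdapted I W) :
    ∃ ℓ : Fin n → Fin m, Function.Surjective ℓ ∧ ∀ i, W i = coordSpan K (ℓ ⁻¹' {i}) := by
  choose S hS using hW.spanned
  replace hS (i) : W i = coordSpan K (S i) := hS i
  have covering (a) : ∃ i, a ∈ S i := by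
    have iSup_eq_top := hW.isInternal.submodule_iSup_eq_top
    rw [funext hS, iSup_coordSpan] at iSup_eq_top
    exact Set.mem_iUnion.1 (varClass_mem_coordSpan.1 (iSup_eq_top ▸ Submodule.mem_top))
  choose ℓ hℓ using covering
  have level_eq (i a) (ha : a ∈ S i) : ℓ a = i := by
    by_contra hne
    have disjoint : Disjoint (W (ℓ a)) (W i) :=
      hW.isInternal.submodule_iSupIndep.pairwiseDisjoint hne
    rw [hS, hS, disjoint_iff, Submodule.eq_bot_iff] at disjoint
    have := disjoint (varClass a) ⟨varClass_mem_coordSpan.2 (hℓ a), varClass_mem_coordSpan.2 ha⟩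
    exact varBasis.ne_zero (R := K) a (by rwa [coe_varBasis])
  have eq_preimage (i) : S i = ℓ ⁻¹' {i} :=
    Set.Subset.antisymm (level_eq i) fun a ha => Set.mem_singleton_iff.1 ha ▸ hℓ a
  refine ⟨ℓ, fun i => ?_, fun i => by rw [hS, eq_preimage]⟩
  obtain ⟨a, ha⟩ := Set.nonempty_iff_ne_empty.2 fun h =>
    hW.ne_bot i ((hS i).trans (coordSpan_eq_bot_iff.2 h))
  exact ⟨a, level_eq i a ha⟩

theorem iSup_coordSpan_preimage (ℓ : Fin n → Fin m) (i : Fin m) :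
    ⨆ j ≤ i, coordSpan K (ℓ ⁻¹' {j}) = coordSpan K {a | ℓ a ≤ i} := by
  simp only [iSup_coordSpan, ← Set.preimage_iUnion]
  rw [show ⋃ j, ⋃ (_ : j ≤ i), {j} = Set.Iic i from Set.biUnion_of_singleton (Set.Iic i)]
  rfl

theorem isAdapted_of_level (hsurj : Function.Surjective ℓ)
    (h : ∀ i, IsPowFixed (idealStabilizer I) {a | ℓ a ≤ i}) :
    IsAdapted I fun i => coordSpan K (ℓ ⁻¹' {i}) where
  isInternal := by
    refine DirectSum.isInternal_submodule_of_iSupIndep_of_iSup_eq_top (fun i => ?_) ?_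
    · simp only [iSup_coordSpan]
      refine disjoint_coordSpan ?_
      simp only [Set.disjoint_iUnion_right]
      exact fun j hj => Disjoint.preimage ℓ (Set.disjoint_singleton.2 hj.symm)
    · rw [iSup_coordSpan, ← Set.preimage_iUnion, Set.iUnion_of_singleton, Set.preimage_univ,
        coordSpan_univ]
  ne_bot i hi := by
    obtain ⟨a, ha⟩ := hsurj i
    exact Set.notMem_empty a (coordSpan_eq_bot_iff.1 hi ▸ ha)
  spanned i := ⟨_, rfl⟩
  partialSum_fixed i g hg := by
    rw [iSup_coordSpan_preimage]
    exact h i g hg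

theorem card_image_le_of_isPowFixed {τ : Type*} [LinearOrder τ] {ℓ' : Fin n → τ}
    (hmax : ∀ (m' : ℕ) (W' : Fin m' → Submodule K (Cot n K)), IsAdapted I W' → m' ≤ m)
    (h : ∀ t, IsPowFixed (idealStabilizer I) {a | ℓ' a ≤ t}) :
    (Finset.univ.image ℓ').card ≤ m := by
  let e := (Finset.univ.image ℓ').orderIsoOfFin rfl
  let rank (a : Fin n) := e.symm ⟨ℓ' a, Finset.mem_image_of_mem ℓ' (Finset.mem_univ a)⟩
  refine hmax _ _ (isAdapted_of_level (ℓ := rank) (fun i => ?_) fun i => ?_)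
  · obtain ⟨a, -, ha⟩ := Finset.mem_image.1 (e i).2
    exact ⟨a, e.symm_apply_eq.2 (Subtype.ext ha)⟩
  · have rank_le (a) : rank a ≤ i ↔ ℓ' a ≤ e i := e.symm_apply_le
    simpa only [rank_le] using h (e i)

theorem isPowFixed_setOf_lt {G : Subgroup (PS n K ≃ₐ[K] PS n K)}
    (h : ∀ i, IsPowFixed G {a | ℓ a ≤ i}) (i : Fin m) : IsPowFixed G {a | ℓ a < i} := by
  by_cases hi : IsMin i
  · simpa only [hi.not_lt, Set.ofPred_false] using IsPowFixed.empty G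
  · simpa only [Order.le_pred_iff_of_not_isMin hi] using h (Order.pred i)

theorem isPowFixed_setOf_toLex_le {G : Subgroup (PS n K ≃ₐ[K] PS n K)} {D : Set (Fin n)}
    (h : ∀ i, IsPowFixed G {a | ℓ a ≤ i}) (hD : IsPowFixed G D) (t : Fin m ×ₗ Prop) :
    IsPowFixed G {a | toLex (ℓ a, a ∉ D) ≤ t} := by
  have upper : IsPowFixed G {a | a ∉ D → (ofLex t).2} := by
    by_cases ht : (ofLex t).2
    · simpa only [ht, imp_true_iff, Set.ofPred_true] using IsPowFixed.univ G
    · simpa only [ht, imp_false, not_not, Set.ofPred_mem_eq] using hD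
  convert (isPowFixed_setOf_lt h (ofLex t).1).union ((h (ofLex t).1).inter upper) using 1
  ext a
  simp only [Prod.Lex.le_iff, ofLex_toLex, Set.mem_ofPred_eq, Set.mem_union, Set.mem_inter_iff,
    le_iff_lt_or_eq (a := ℓ a), le_Prop_eq]
  tauto

theorem mem_iff_mem_of_level_eq {D : Set (Fin n)} (hsurj : Function.Surjective ℓ)
    (hmax : ∀ (m' : ℕ) (W' : Fin m' → Submodule K (Cot n K)), IsAdapted I W' → m' ≤ m)
    (h : ∀ i, IsPowFixed (idealStabilizer I) {a | ℓ a ≤ i}) (hD : IsPowFixed (idealStabilizer I) D)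
    {a c : Fin n} (hac : ℓ a = ℓ c) : a ∈ D ↔ c ∈ D := by
  classical
  let ℓ' (x : Fin n) : Fin m ×ₗ Prop := toLex (ℓ x, x ∉ D)
  have card_le := card_image_le_of_isPowFixed hmax (isPowFixed_setOf_toLex_le h hD)
  have image_fst : (Finset.univ.image ℓ').image (fun t => (ofLex t).1) = Finset.univ := by
    rw [Finset.image_image]
    exact Finset.image_univ_of_surjective hsurj
  have fst_injOn : Set.InjOn (fun t : Fin m ×ₗ Prop => (ofLex t).1) (Finset.univ.image ℓ') := by
    refine Finset.card_image_iff.1 (Finset.card_image_le.antisymm (card_le.trans_eq ?_))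
    rw [image_fst, Finset.card_fin]
  have level'_eq : ℓ' a = ℓ' c := fst_injOn (by simp) (by simp) hac
  exact not_iff_not.1 (Iff.of_eq (congrArg (fun t => (ofLex t).2) level'_eq))

end Levels

end Alignment

theorem lemma3p2_general {K : Type*} [Field K] {n r m : ℕ}
    (I : Fin r → Ideal (Alignment.PS n K))
    (hmon : ∀ j, Alignment.IsMonomialIdeal (I j))
    (W : Fin m → Submodule K (Alignment.Cot n K))
    (hW : Alignment.IsAdapted I W)
    (hmax : ∀ (m' : ℕ) (W' : Fin m' → Submodule K (Alignment.Cot n K)),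
      Alignment.IsAdapted I W' → m' ≤ m)
    (g : Alignment.PS n K ≃ₐ[K] Alignment.PS n K)
    (hdeg : Alignment.IsDegreePreserving g)
    (hfix : ∀ i, Alignment.Fixes g (W i)) :
    g ∈ Alignment.idealStabilizer I := by
  obtain ⟨ℓ, hsurj, hℓ⟩ := hW.exists_level
  have level_eq (a b) (hab : Alignment.linMatrix g a b ≠ 0) : ℓ a = ℓ b := by
    have fixes := hfix (ℓ a)
    rw [hℓ, Alignment.fixes_coordSpan_iff] at fixes
    by_contra hne
    exact hab (fixes a rfl b (Ne.symm hne))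
  have partialSum_fixed (i) : Alignment.IsPowFixed (Alignment.idealStabilizer I) {a | ℓ a ≤ i} := by
    simpa only [Alignment.IsPowFixed, hℓ, Alignment.iSup_coordSpan_preimage] using
      hW.partialSum_fixed i
  have hasRootSubgroup (j a b) (hab : ℓ a = ℓ b) :
      Alignment.HasRootSubgroup K (Alignment.exponents (I j)) a b :=
    (Alignment.mem_iff_mem_of_level_eq hsurj hmax partialSum_fixed
      (Alignment.isPowFixed_setOf_hasRootSubgroup (hmon j) a) hab).1 (.refl _ a)
  have linMatrix_mem (j) :
      Alignment.linMatrix g ∈ Alignment.expStabilizer K (Alignment.exponents (I j)) :=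
    Alignment.mem_of_diagonal_mem_of_transvection_mem Alignment.diagonal_mem_expStabilizer
      (fun a b c _ hab => (hasRootSubgroup j a b hab).transvection_mem c) level_eq
  exact fun j => Alignment.map_mem_iff_of_forall_map_mem (e := g.toRingEquiv) fun f hf =>
    hdeg.map_mem (hmon j) (linMatrix_mem j) hf

theorem lemma3p2 {K : Type*} [Field K] {n r m : ℕ}
    (I : Fin r → Ideal (Alignment.PS n K))
    (hmon : ∀ j, Alignment.IsMonomialIdeal (I j))
    (hcol : ∀ j, Alignment.HasFiniteColength (I j))
    (W : Fin m → Submodule K (Alignment.Cot n K))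
    (hW : Alignment.IsAdapted I W)
    (hmax : ∀ (m' : ℕ) (W' : Fin m' → Submodule K (Alignment.Cot n K)),
      Alignment.IsAdapted I W' → m' ≤ m)
    (g : Alignment.PS n K ≃ₐ[K] Alignment.PS n K)
    (hdeg : Alignment.IsDegreePreserving g)
    (hfix : ∀ i, Alignment.Fixes g (W i)) :
    g ∈ Alignment.idealStabilizer I :=
  lemma3p2_general I hmon W hW hmax g hdeg hfix
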